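/- **Notation.** Let $\hbar$ be a formal variable, $\mathcal{C}=\mathbb{Q}[\hbar]$, and let $\mathfrak{h}^1$ be the non-commutative polynomial algebra over $\mathcal{C}$ freely generated by letters $z_1,z_2,z_3,\dots$. Let $\mathfrak{h}^1_{>0}\subset\mathfrak{h}^1$ be the $\mathcal{C}$-submodule spanned by the non-empty words $z_{k_1}\cdots z_{k_r}$ ($r\ge 1$), and $\mathfrak{h}^0\subset\mathfrak{h}^1$ the $\mathcal{C}$-submodule spanned by $1$ and the words with $r\ge1$, $k_1\ge 2$. All maps and products below are extended $\mathcal{C}$-linearly, respectively $\mathcal{C}$-bilinearly; $i,j\ge 1$ and $w,w',w''\in\mathfrak{h}^1$. - The products $\overline{*}$ and $*_+$ on $\mathfrak{h}^1$ have $1$ as a two-sided unit and satisfy $$(z_iw')\,\overline{*}\,(z_jw'')=z_i(w'\,\overline{*}\,z_jw'')+z_j(z_iw'\,\overline{*}\,w'')-z_{i+j}(w'\,\overline{*}\,w''),$$ $$(z_iw')*_+(z_jw'')=z_i(w'*_+z_jw'')+z_j(z_iw'*_+w'')+(z_{i+j}+\hbar z_{i+j-1})(w'*_+w'').$$ - The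 product $\circledast_q$ on $\mathfrak{h}^1_{>0}$ is given by $(z_iw')\circledast_q(z_jw'')=z_{i+j}(w'*_+w'')$. - The map $d:\mathfrak{h}^1\to\mathfrak{h}^1$ is given by $d(1)=1$ and $d(z_iw)=z_i\,d(w)+z_i\circ d(w)$, where $z_i\circ 1=0$ and $z_i\circ(z_jw)=z_{i+j}w$. - The map $\phi:\mathfrak{h}^1\to\mathfrak{h}^1$ is given on a word $u=z_{k_1}\cdots z_{k_r}$ as follows. Let $I_u=\{k_1+\cdots+k_j\mid 1\le j<r\}$ and $\{1,2,\dots,k_1+\cdots+k_r\}\setminus I_u=\{p_1<\cdots<p_l\}$. Then $\phi(u)=z_{p_1}z_{p_2-p_1}\cdots z_{p_l-p_{l-1}}$ (and $\phi(1)=1$). - Let $\mathcal{R}=\mathbb{Q}[[q]]$ with the $q$-adic topology, and let $\hbar$ act on $\mathcal{R}$ as multiplication by $1-q$. Put $[m]=\frac{1-q^m}{1-q}$. For a word $u=z_{k_1}\cdots z_{k_r}$ and $n\ge 0$ let $$A_u(n)=\sum_{n\ge m_1>\cdots>m_r>0}\frac{q^{(k_1-1)m_1+\cdots+(k_r-1)m_r}}{[m_1]^{k_1}\cdots[m_r]^{k_r}},\qquad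 A_1(n)=1,$$ extended $\mathcal{C}$-linearly to $w\mapsto A_w(n)\in\mathcal{R}$. For $w\in\mathfrak{h}^0$ the limit $\zeta_q(w)=\lim_{n\to\infty}A_w(n)$ exists in $\mathcal{R}$; it is the $q$-analogue of the multiple zeta value. **Theorem** ($q$-analogue of Kawashima's relation). For all $w_1,w_2\in\mathfrak{h}^1_{>0}$ and all integers $n\ge1$, the following relation holds in $\mathbb{Q}[[q]]$: $$\zeta_q\bigl(d(\phi(w_1\,\overline{*}\,w_2))\circledast_q z_1^n\bigr)+\sum_{\substack{k+l=n\\ k,l\ge1}}\zeta_q\bigl(d(\phi(w_1))\circledast_q z_1^k\bigr)\,\zeta_q\bigl(d(\phi(w_2))\circledast_q z_1^l\bigr)=0.$$ -/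

import Mathlib

open Filter

namespace QMZV

noncomputable section

/-! ## The algebra of words -/

/-- The coefficient ring `𝒞 = ℚ[ħ]`. -/
abbrev Coeff : Type := Polynomial ℚ

/-- The formal variable `ħ`. -/
def hbar : Coeff := Polynomial.X

/-- The non-commutative polynomial algebra `𝔥¹` over `𝒞`, freely generated by the letters `z_k`,
`k = 1, 2, 3, …`. -/
abbrev H1 : Type := FreeAlgebra Coeff ℕ+

/-- The letter `z_k`. -/
def z (k : ℕ+) : H1 := FreeAlgebra.ι Coeff k

/-- The word `z_{k₁} ⋯ z_{k_r}` with index list `[k₁, …, k_r]`; the empty list gives `1`. -/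
def word (u : List ℕ+) : H1 := (u.map z).prod

/-- The `𝒞`-basis of `𝔥¹` consisting of all words. -/
def wordBasis : Module.Basis (List ℕ+) Coeff H1 :=
  (FreeAlgebra.basisFreeMonoid Coeff ℕ+).reindex FreeMonoid.toList

theorem wordBasis_apply (u : List ℕ+) : wordBasis u = word u := by
  rw [wordBasis, Module.Basis.reindex_apply, FreeAlgebra.basisFreeMonoid, Module.Basis.map_apply]
  apply FreeAlgebra.equivMonoidAlgebraFreeMonoid.injective
  have h : ∀ v : List ℕ+, FreeAlgebra.equivMonoidAlgebraFreeMonoid (word v) =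
      MonoidAlgebra.single (FreeMonoid.ofList v) (1 : Coeff) := by
    intro v
    induction v with
    | nil => simp [word, MonoidAlgebra.one_def]
    | cons k v ih =>
      have : word (k :: v) = z k * word v := by simp [word]
      rw [this, map_mul, ih]
      simp [z, FreeAlgebra.equivMonoidAlgebraFreeMonoid, MonoidAlgebra.single_mul_single]
  rw [h]
  simp

/-- The `𝒞`-linear extension of a map given on words. -/
def linExt (f : List ℕ+ → H1) : H1 →ₗ[Coeff] H1 :=
  wordBasis.constr Coeff f

/-- The `𝒞`-bilinear extension of a map given on pairs of words. -/
def bilinExt (f : List ℕ+ → List ℕ+ → H1) : H1 →ₗ[Coeff] H1 →ₗ[Coeff] H1 :=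
  wordBasis.constr Coeff fun u => linExt (f u)

theorem linExt_word (f : List ℕ+ → H1) (u : List ℕ+) : linExt f (word u) = f u := by
  rw [← wordBasis_apply, linExt, Module.Basis.constr_basis]

theorem bilinExt_word (f : List ℕ+ → List ℕ+ → H1) (u v : List ℕ+) :
    bilinExt f (word u) (word v) = f u v := by
  rw [← wordBasis_apply u, bilinExt, Module.Basis.constr_basis, linExt_word]

/-- The submodule `𝔥¹_{>0}` of non-constant elements, spanned by the non-empty words. -/
def H1pos : Submodule Coeff H1 := Submodule.span Coeff (word '' {u | u ≠ []})

/-- The submodule `𝔥⁰` spanned by `1` and the words `z_{k₁} ⋯ z_{k_r}` with `r ≥ 1`, `k₁ ≥ 2`. -/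
def H0 : Submodule Coeff H1 := Submodule.span Coeff (word '' {u | ∀ k ∈ u.head?, 2 ≤ k})

/-! ## Products and maps on `𝔥¹` -/

/-- The quasi-shuffle recursion on words whose diagonal term is `c i j = "z_i ∘ z_j"`:
`z_i w₁ * z_j w₂ = z_i (w₁ * z_j w₂) + z_j (z_i w₁ * w₂) + c i j (w₁ * w₂)`. -/
def quasiShuffle (c : ℕ+ → ℕ+ → H1) : List ℕ+ → List ℕ+ → H1
  | [], v => word v
  | i :: u, [] => word (i :: u)
  | i :: u, j :: v =>
      z i * quasiShuffle c u (j :: v) + z j * quasiShuffle c (i :: u) v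
        + c i j * quasiShuffle c u v
termination_by u v => u.length + v.length

/-- The product `*₊`, with diagonal term `z_i ∘₊ z_j = z_{i+j} + ħ z_{i+j-1}`. -/
def starPlus : H1 →ₗ[Coeff] H1 →ₗ[Coeff] H1 :=
  bilinExt (quasiShuffle fun i j => z (i + j) + hbar • z (i + j - 1))

/-- The product `*̄`, with diagonal term `-z_{i+j}`. -/
def starBar : H1 →ₗ[Coeff] H1 →ₗ[Coeff] H1 :=
  bilinExt (quasiShuffle fun i j => -z (i + j))

/-- The action of the letter `z_i` on `𝔥¹`: `z_i ∘ 1 = 0` and `z_i ∘ (z_j w) = z_{i+j} w`. -/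
def circ (i : ℕ+) : H1 →ₗ[Coeff] H1 :=
  linExt fun
    | [] => 0
    | j :: u => word ((i + j) :: u)

/-- The map `d` on words: `d(1) = 1` and `d(z_i w) = z_i d(w) + z_i ∘ d(w)`. -/
def dWord : List ℕ+ → H1
  | [] => 1
  | i :: u => z i * dWord u + circ i (dWord u)

/-- The `𝒞`-linear map `d` on `𝔥¹`. -/
def d : H1 →ₗ[Coeff] H1 := linExt dWord

/-- The product `⊛_q`: `(z_i w₁) ⊛_q (z_j w₂) = z_{i+j} (w₁ *₊ w₂)`. It is a product on `𝔥¹_{>0}`;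
it is extended to all of `𝔥¹` by letting it vanish when one of the factors is constant. -/
def circledast : H1 →ₗ[Coeff] H1 →ₗ[Coeff] H1 :=
  bilinExt fun
    | i :: u, j :: v => z (i + j) * starPlus (word u) (word v)
    | _, _ => 0

/-- The weight `k₁ + ⋯ + k_r` of the word `z_{k₁} ⋯ z_{k_r}`. -/
def weight (u : List ℕ+) : ℕ := (u.map fun k => (k : ℕ)).sum

/-- The set `I_u = {k₁ + ⋯ + k_j | 1 ≤ j < r}` of the word `u = z_{k₁} ⋯ z_{k_r}`. -/
def partialSums (u : List ℕ+) : Finset ℕ :=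
  (Finset.Ico 1 u.length).image fun j => weight (u.take j)

/-- The elements `p₁ < ⋯ < p_l` of `I_uᶜ = {1, …, k₁ + ⋯ + k_r} ∖ I_u`, in increasing order. -/
def complementSums (u : List ℕ+) : List ℕ :=
  (List.range' 1 (weight u)).filter fun p => p ∉ partialSums u

/-- The successive differences `p₁ - p₀, p₂ - p₁, …, p_l - p_{l-1}` of the increasing sequence
`p₀ < p₁ < ⋯ < p_l`. -/
def differences : ℕ → List ℕ → List ℕ+
  | _, [] => []
  | p₀, p :: l => (p - p₀).toPNat' :: differences p l

/-- The map `φ` on index lists: `(p₁, p₂ - p₁, …, p_l - p_{l-1})` where `I_uᶜ = {p₁ < ⋯ < p_l}`. -/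
def phiWord (u : List ℕ+) : List ℕ+ := differences 0 (complementSums u)

/-- The `𝒞`-linear map `φ` on `𝔥¹`. -/
def phi : H1 →ₗ[Coeff] H1 := linExt fun u => word (phiWord u)

/-! ## The q-series -/

/-- The ring `ℛ = ℚ[[q]]`; the variable `q` is `PowerSeries.X`. -/
abbrev R : Type := PowerSeries ℚ

/-- The variable `q`. -/
def q : R := PowerSeries.X

/-- The ring homomorphism `𝒞 → ℛ`, `ħ ↦ 1 - q`, through which `𝒞` acts on `ℛ`. (Mathlib's instance
`Algebra ℚ[X] ℚ⟦X⟧` sends the variable to `q` and is not used.) -/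
def coeffHom : Coeff →+* R := (Polynomial.aeval (1 - q)).toRingHom

/-- The q-integer `[m] = (1 - q^m) / (1 - q)`. -/
def qInt (m : ℕ) : R := (1 - q ^ m) * (1 - q)⁻¹

/-- For a word `u = z_{k₁} ⋯ z_{k_r}`, the sum
`A_u(n) = ∑_{n ≥ m₁ > ⋯ > m_r > 0} ∏ᵢ q^{(kᵢ - 1) mᵢ} / [mᵢ]^{kᵢ}`, with `A_1(n) = 1`,
written as an iterated sum over `m₁`, then `m₂ ≤ m₁ - 1`, and so on. -/
def AWord : List ℕ+ → ℕ → R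
  | [], _ => 1
  | k :: u, n => ∑ m ∈ Finset.Icc 1 n,
      q ^ (((k : ℕ) - 1) * m) * (qInt m ^ (k : ℕ))⁻¹ * AWord u (m - 1)

/-- The `𝒞`-linear extension `w ↦ A_w` of `u ↦ A_u`, where `ħ` acts on `ℛ` as `1 - q`. -/
def A (w : H1) (n : ℕ) : R :=
  (wordBasis.repr w).sum fun u c => coeffHom c * AWord u n

/-- The q-adic topology on `ℛ`. -/
@[reducible] def qAdic : TopologicalSpace R := (Ideal.span {q} : Ideal R).adicTopology

/-- The q-analogue of the multiple zeta value, `ζ_q(w) = lim_{n → ∞} A_w(n)` in `ℛ` with its q-adic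
topology. The limit exists for `w ∈ 𝔥⁰` (`tendsto_zetaQ`). -/
def zetaQ (w : H1) : R :=
  @limUnder R qAdic ℕ ⟨0⟩ atTop fun n => A w n

/-! ## Convergence of the q-series on `𝔥⁰` -/

theorem A_add (w w' : H1) (n : ℕ) : A (w + w') n = A w n + A w' n := by
  unfold A
  rw [map_add, Finsupp.sum_add_index'] <;> intros <;> simp [add_mul]

theorem A_smul (c : Coeff) (w : H1) (n : ℕ) : A (c • w) n = coeffHom c * A w n := by
  unfold A
  rw [map_smul, Finsupp.sum_smul_index, Finsupp.mul_sum] <;> intros <;> simp [mul_assoc]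

theorem A_word (u : List ℕ+) (n : ℕ) : A (word u) n = AWord u n := by
  unfold A
  rw [← wordBasis_apply, Module.Basis.repr_self, Finsupp.sum_single_index] <;> simp

theorem q_pow_dvd_A_succ_sub {w : H1} (hw : w ∈ H0) (n : ℕ) :
    q ^ (n + 1) ∣ A w (n + 1) - A w n := by
  induction hw using Submodule.span_induction with
  | mem x hx =>
    obtain ⟨u, hu, rfl⟩ := hx
    rw [A_word, A_word]
    cases u with
    | nil => simp [AWord]
    | cons k u =>
      have hk : 2 ≤ k := hu k rfl
      have hk' : 2 ≤ (k : ℕ) := by exact_mod_cast hk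
      simp only [AWord]
      rw [Finset.sum_Icc_succ_top (by omega), add_sub_cancel_left]
      refine Dvd.dvd.mul_right (Dvd.dvd.mul_right (pow_dvd_pow _ ?_) _) _
      exact Nat.le_mul_of_pos_left _ (by omega)
  | zero => simp [A]
  | add x y _ _ hx hy =>
    rw [A_add, A_add, add_sub_add_comm]
    exact dvd_add hx hy
  | smul c x _ hx =>
    rw [A_smul, A_smul, ← mul_sub]
    exact hx.mul_left _

theorem exists_qlimit {b : ℕ → R} (hb : ∀ n, q ^ (n + 1) ∣ b (n + 1) - b n) :
    ∃ L : R, ∀ N n, N ≤ n → q ^ N ∣ b n - L := by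
  have key : ∀ m n, m ≤ n → PowerSeries.coeff m (b n) = PowerSeries.coeff m (b m) := by
    intro m n h
    induction n, h using Nat.le_induction with
    | base => rfl
    | succ n hmn ih =>
      have := PowerSeries.X_pow_dvd_iff.1 (hb n) m (by omega)
      rw [map_sub, sub_eq_zero] at this
      rw [this, ih]
  refine ⟨PowerSeries.mk fun m => PowerSeries.coeff m (b m), fun N n hn => ?_⟩
  refine PowerSeries.X_pow_dvd_iff.2 fun m hm => ?_
  rw [map_sub, PowerSeries.coeff_mk, key m n (by omega), sub_self]

theorem tendsto_qAdic_iff {b : ℕ → R} {L : R} :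
    Tendsto b atTop (@nhds R qAdic L) ↔ ∀ N, ∀ᶠ n in atTop, q ^ N ∣ b n - L := by
  unfold qAdic
  rw [((Ideal.span {q} : Ideal R).hasBasis_nhds_adic L).tendsto_right_iff]
  simp only [true_imp_iff]
  refine forall_congr' fun N => eventually_congr (Eventually.of_forall fun n => ?_)
  rw [Ideal.span_singleton_pow]
  constructor
  · rintro ⟨y, hy, h⟩
    rw [← h, add_sub_cancel_left]
    exact Ideal.mem_span_singleton.1 hy
  · intro h
    exact ⟨b n - L, Ideal.mem_span_singleton.2 h, by ring⟩

/-- Limits in the q-adic topology are unique. -/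
theorem qAdic_limit_unique {b : ℕ → R} {L L' : R} (h : Tendsto b atTop (@nhds R qAdic L))
    (h' : Tendsto b atTop (@nhds R qAdic L')) : L = L' := by
  rw [tendsto_qAdic_iff] at h h'
  ext m
  obtain ⟨n, h₁, h₂⟩ := ((h (m + 1)).and (h' (m + 1))).exists
  have e₁ := PowerSeries.X_pow_dvd_iff.1 h₁ m (by omega)
  have e₂ := PowerSeries.X_pow_dvd_iff.1 h₂ m (by omega)
  rw [map_sub, sub_eq_zero] at e₁ e₂
  rw [← e₁, e₂]

/-- For `w ∈ 𝔥⁰` the limit that defines `ζ_q(w)` exists. -/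
theorem tendsto_zetaQ {w : H1} (hw : w ∈ H0) :
    Tendsto (fun n => A w n) atTop (@nhds R qAdic (zetaQ w)) := by
  obtain ⟨L, hL⟩ := exists_qlimit (q_pow_dvd_A_succ_sub hw)
  exact @tendsto_nhds_limUnder R ℕ qAdic atTop (fun n => A w n)
    ⟨L, tendsto_qAdic_iff.2 fun N => eventually_atTop.2 ⟨N, fun n hn => hL N n hn⟩⟩

/-- Every product `w ⊛_q w'` lies in `𝔥⁰`, so that `ζ_q` is defined on it. -/
theorem circledast_mem_H0 (w w' : H1) : circledast w w' ∈ H0 := by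
  have hz : ∀ (i j : ℕ+) (x : H1), z (i + j) * x ∈ H0 := by
    intro i j x
    rw [← wordBasis.linearCombination_repr x, Finsupp.linearCombination_apply, Finsupp.sum,
      Finset.mul_sum]
    refine Submodule.sum_mem _ fun u _ => ?_
    rw [mul_smul_comm, wordBasis_apply]
    refine Submodule.smul_mem _ _ (Submodule.subset_span ⟨(i + j) :: u, ?_, by simp [word]⟩)
    intro k hk
    obtain rfl : i + j = k := by simpa using hk
    exact add_le_add one_le one_le
  rw [circledast, bilinExt, Module.Basis.constr_apply, Finsupp.sum, LinearMap.sum_apply]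
  refine Submodule.sum_mem _ fun u _ => ?_
  rw [LinearMap.smul_apply, linExt, Module.Basis.constr_apply]
  refine Submodule.smul_mem _ _ (Submodule.sum_mem _ fun v _ => Submodule.smul_mem _ _ ?_)
  cases u with
  | nil => exact Submodule.zero_mem _
  | cons i u =>
    cases v with
    | nil => exact Submodule.zero_mem _
    | cons j v => exact hz i j _

end

end QMZV

open QMZV

open Filter

namespace QMZV

noncomputable section

/-! ## Linear extension and induction over words -/

/-! For `w` in `𝔥¹_{>0}`, put `a = A_{d(φ(w))}` and consider the q-Newton series `F_w(T) = ∑_{m ≥ 1}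
(a(m) - a(m-1)) q^m ∏_{j < m} (T + [j]) / [j+1]`. It can be read in two ways. Expanded in powers of
`T`, its constant term is zero and its coefficient at `T^n` is `ζ_q(d(φ(w)) ⊛_q z₁^n)`: the
coefficients of the Newton polynomials are the sums attached to powers of `z₁`, and `⊛_q` glues the
outer summation indices (`newton_coeff_succ`, `A_circledast_z_one_pow`). Evaluated at `T = -[n]`,
the series terminates and equals `-S_w(n)`, a non-strict multiple harmonic sum
(`newtonSum_dWord_phiWord`). The proof grows words from `z₁` by raising the first letter or
prefixing `z₁`. The duality `φ` exchanges these moves, and each yields a first-order difference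
equation in `n`. Since `*̄` multiplies non-strict sums, `F_{w₁ *̄ w₂} + F_{w₁} F_{w₂}` vanishes at
every `-[n]`. The relation is the vanishing of its coefficients. These infinitely many zeros are
used through truncations. Modulo `q^{k+1}` only the first `k` Newton terms of each factor matter, so
the degree drops below the number of exact zeros available, and division by a monic polynomial gives
divisibility by `q^{k+1}` (`C_dvd_of_eval_eq_zero`). Letting `k` grow gives the identity of limits.
-/

theorem word_nil : word [] = 1 := rfl

theorem word_cons (k : ℕ+) (u : List ℕ+) : word (k :: u) = z k * word u := by
  simp [word]

/-- Induction principle for `𝔥¹`: additive, `𝒞`-homogeneous predicates are checked on words. -/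
theorem induction_word {p : H1 → Prop} (hword : ∀ u, p (word u))
    (hadd : ∀ x y, p x → p y → p (x + y)) (hsmul : ∀ (c : Coeff) x, p x → p (c • x)) (w : H1) :
    p w := by
  have hw : w ∈ Submodule.span Coeff (Set.range wordBasis) := by
    rw [wordBasis.span_eq]; trivial
  induction hw using Submodule.span_induction with
  | mem x hx =>
    obtain ⟨u, rfl⟩ := hx
    rw [wordBasis_apply]; exact hword u
  | zero => simpa using hsmul 0 _ (hword [])
  | add x y _ _ hx hy => exact hadd x y hx hy
  | smul c x _ hx => exact hsmul c x hx

/-- The extension of an `ℛ`-valued function on words to `𝔥¹`, semilinear along `coeffHom`. -/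
def wordSum (F : List ℕ+ → R) (w : H1) : R :=
  (wordBasis.repr w).sum fun u c => coeffHom c * F u

theorem wordSum_add (F : List ℕ+ → R) (w w' : H1) :
    wordSum F (w + w') = wordSum F w + wordSum F w' := by
  unfold wordSum
  rw [map_add, Finsupp.sum_add_index'] <;> intros <;> simp [add_mul]

theorem wordSum_smul (F : List ℕ+ → R) (c : Coeff) (w : H1) :
    wordSum F (c • w) = coeffHom c * wordSum F w := by
  unfold wordSum
  rw [map_smul, Finsupp.sum_smul_index, Finsupp.mul_sum] <;> intros <;> simp [mul_assoc]

theorem wordSum_neg (F : List ℕ+ → R) (w : H1) : wordSum F (-w) = -wordSum F w := by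
  rw [← neg_one_smul Coeff w, wordSum_smul, map_neg, map_one, neg_one_mul]

theorem wordSum_word (F : List ℕ+ → R) (u : List ℕ+) : wordSum F (word u) = F u := by
  unfold wordSum
  rw [← wordBasis_apply, Module.Basis.repr_self, Finsupp.sum_single_index] <;> simp

theorem A_zero (n : ℕ) : A 0 n = 0 := by simp [A]

theorem exists_coe_eq_add_one (k : ℕ+) : ∃ m : ℕ, (k : ℕ) = m + 1 :=
  ⟨k.natPred, k.natPred_add_one.symm⟩

theorem neg_z_mul (k : ℕ+) (w : H1) : -z k * w = -(z k * w) := by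
  rw [← neg_one_smul Coeff (z k), smul_mul_assoc, neg_one_smul]

theorem A_one (n : ℕ) : A 1 n = 1 := by rw [← word_nil, A_word, AWord]

theorem coeffHom_hbar : coeffHom hbar = 1 - q := by
  simp [coeffHom, hbar]

/-! ## q-integers -/

theorem one_sub_q_mul_inv : (1 - q) * (1 - q)⁻¹ = 1 :=
  PowerSeries.mul_inv_cancel _ (by simp [q])

theorem one_sub_q_mul_qInt (m : ℕ) : (1 - q) * qInt m = 1 - q ^ m := by
  rw [qInt]; linear_combination (1 - q ^ m) * one_sub_q_mul_inv

theorem qInt_zero : qInt 0 = 0 := by simp [qInt]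

theorem qInt_succ (m : ℕ) : qInt (m + 1) = q * qInt m + 1 := by
  simp only [qInt]; linear_combination one_sub_q_mul_inv

theorem constantCoeff_qInt_succ (m : ℕ) : PowerSeries.constantCoeff (qInt (m + 1)) = 1 := by
  rw [qInt_succ]; simp [q]

theorem qInt_mul_inv {m : ℕ} (hm : 1 ≤ m) : qInt m * (qInt m)⁻¹ = 1 := by
  obtain ⟨m, rfl⟩ := Nat.exists_eq_add_of_le' hm
  exact PowerSeries.mul_inv_cancel _ (by rw [constantCoeff_qInt_succ]; exact one_ne_zero)

theorem inv_pow_powerSeries (x : R) (k : ℕ) : (x ^ k)⁻¹ = x⁻¹ ^ k := by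
  induction k with
  | zero => simp
  | succ k ih => rw [pow_succ, PowerSeries.mul_inv_rev, ih, pow_succ, mul_comm]

theorem q_pow_injective : Function.Injective fun m : ℕ => q ^ m := by
  intro a b h
  have := congrArg PowerSeries.order h
  simpa [q, PowerSeries.order_X_pow] using this

/-- Makes the interpolation nodes `-[n]` distinct, so that zeros can be counted. -/
theorem qInt_injective : Function.Injective qInt := by
  intro a b h
  apply q_pow_injective
  have := congrArg ((1 - q) * ·) h
  simp only [one_sub_q_mul_qInt] at this
  simpa using this

/-! ## Strict sums -/

theorem A_zero_word_cons (k : ℕ+) (u : List ℕ+) : A (word (k :: u)) 0 = 0 := by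
  simp [A_word, AWord]

theorem AWord_cons_succ (k : ℕ+) (u : List ℕ+) (n : ℕ) :
    AWord (k :: u) (n + 1) = AWord (k :: u) n +
      q ^ (((k : ℕ) - 1) * (n + 1)) * (qInt (n + 1))⁻¹ ^ (k : ℕ) * AWord u n := by
  simp only [AWord]
  rw [Finset.sum_Icc_succ_top (by omega), inv_pow_powerSeries, Nat.add_sub_cancel]

theorem A_z_mul_zero (k : ℕ+) (w : H1) : A (z k * w) 0 = 0 := by
  induction w using induction_word with
  | hword u => rw [← word_cons, A_zero_word_cons]
  | hadd x y hx hy => rw [mul_add, A_add, hx, hy, add_zero]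
  | hsmul c x hx => rw [mul_smul_comm, A_smul, hx, mul_zero]

theorem A_z_mul_succ (k : ℕ+) (w : H1) (n : ℕ) :
    A (z k * w) (n + 1) = A (z k * w) n +
      q ^ (((k : ℕ) - 1) * (n + 1)) * (qInt (n + 1))⁻¹ ^ (k : ℕ) * A w n := by
  induction w using induction_word with
  | hword u => rw [← word_cons, A_word, A_word, A_word, AWord_cons_succ]
  | hadd x y hx hy => simp only [mul_add, A_add, hx, hy]; ring
  | hsmul c x hx => simp only [mul_smul_comm, A_smul, hx]; ring

theorem A_circ_zero (k : ℕ+) (w : H1) : A (circ k w) 0 = 0 := by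
  induction w using induction_word with
  | hword u =>
    rw [circ, linExt_word]
    cases u with
    | nil => exact A_zero 0
    | cons j u => exact A_zero_word_cons _ _
  | hadd x y hx hy => rw [map_add, A_add, hx, hy, add_zero]
  | hsmul c x hx => rw [map_smul, A_smul, hx, mul_zero]

theorem A_circ_succ (k : ℕ+) (w : H1) (n : ℕ) :
    A (circ k w) (n + 1) = A (circ k w) n +
      (q ^ (n + 1)) ^ (k : ℕ) * (qInt (n + 1))⁻¹ ^ (k : ℕ) * (A w (n + 1) - A w n) := by
  induction w using induction_word with
  | hword u =>
    rw [circ, linExt_word]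
    cases u with
    | nil => simp [A_word, AWord, A_zero]
    | cons j u =>
      simp only [A_word, AWord_cons_succ]
      obtain ⟨j', hj⟩ := exists_coe_eq_add_one j
      -- Only one of the merged indices carries the shift `-1` in its `q`-exponent, so `z_k ∘`
      -- contributes the full factor `(q^m / [m])^k`.
      have : ((k + j : ℕ+) : ℕ) - 1 = k + j' := by rw [PNat.add_coe]; omega
      rw [this, PNat.add_coe, hj, Nat.add_sub_cancel]
      ring
  | hadd x y hx hy => simp only [map_add, A_add, hx, hy]; ring
  | hsmul c x hx => simp only [map_smul, A_smul, hx]; ring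

/-- The product `*₊` is the product of the strict sums. -/
theorem A_quasiShuffle (u v : List ℕ+) (n : ℕ) :
    A (quasiShuffle (fun i j => z (i + j) + hbar • z (i + j - 1)) u v) n =
      AWord u n * AWord v n := by
  set c : ℕ+ → ℕ+ → H1 := fun i j => z (i + j) + hbar • z (i + j - 1) with hc
  induction u, v using quasiShuffle.induct generalizing n with
  | case1 v => rw [quasiShuffle, A_word, AWord, one_mul]
  | case2 i u => rw [quasiShuffle, A_word, AWord, mul_one]
  | case3 i u j v ih1 ih2 ih3 =>
    rw [quasiShuffle]
    induction n with
    | zero =>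
      simp only [hc, add_mul, smul_mul_assoc, A_add, A_smul, A_z_mul_zero]
      simp [AWord]
    | succ n ih =>
      simp only [hc, add_mul, smul_mul_assoc, A_add, A_smul, coeffHom_hbar] at ih ⊢
      rw [← hc] at ih ⊢
      simp only [A_z_mul_succ, ih1, ih2, ih3, AWord_cons_succ] at ih ⊢
      obtain ⟨i', hi⟩ := exists_coe_eq_add_one i
      obtain ⟨j', hj⟩ := exists_coe_eq_add_one j
      have h1 : ((i + j : ℕ+) : ℕ) = i' + j' + 2 := by rw [PNat.add_coe]; omega
      -- Subtraction in `ℕ+` is truncated at `1`; it is genuine here because `1 < i + j`.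
      have h2 : ((i + j - 1 : ℕ+) : ℕ) = i' + j' + 1 := by
        rw [PNat.sub_coe, if_pos (lt_of_lt_of_le (PNat.lt_add_right 1 j)
          (add_le_add_left (one_le (a := i)) j)), h1]
        simp
      rw [h1, h2, hi, hj]
      simp only [Nat.add_sub_cancel, show i' + j' + 2 - 1 = i' + j' + 1 by omega]
      -- The two diagonal contributions combine through `q^m + (1 - q)[m] = 1` with `m = n + 1`,
      -- which is why the correction `ħ z_{i+j-1}` appears.
      linear_combination ih + q ^ ((i' + j') * (n + 1)) * (qInt (n + 1))⁻¹ ^ (i' + j' + 1) *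
        (AWord u n * AWord v n) * ((qInt (n + 1))⁻¹ * one_sub_q_mul_qInt (n + 1) -
          (1 - q) * qInt_mul_inv (Nat.le_add_left 1 n))

theorem A_starPlus (w w' : H1) (n : ℕ) : A (starPlus w w') n = A w n * A w' n := by
  induction w using induction_word with
  | hword u =>
    induction w' using induction_word with
    | hword v => rw [starPlus, bilinExt_word, A_quasiShuffle, A_word, A_word]
    | hadd x y hx hy => rw [map_add, A_add, hx, hy, A_add, mul_add]
    | hsmul c x hx => rw [map_smul, A_smul, hx, A_smul, mul_left_comm]
  | hadd x y hx hy => rw [map_add, LinearMap.add_apply, A_add, hx, hy, A_add, add_mul]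
  | hsmul c x hx => rw [map_smul, LinearMap.smul_apply, A_smul, hx, A_smul, mul_assoc]

theorem z_one_pow (k : ℕ) : z 1 ^ k = word (List.replicate k 1) := by
  simp [word]

/-- Merging the outer letters forces a common outer index `m + 1`, while `*₊` multiplies the inner
sums. The increment of `A_w` is the outer summand of `w`; the letter `z₁` adds `q^{m+1} / [m+1]`. -/
theorem A_circledast_z_one_pow (w : H1) (k n : ℕ) :
    A (circledast w (z 1 ^ (k + 1))) n = ∑ m ∈ Finset.range n,
      (A w (m + 1) - A w m) * (q ^ (m + 1) * (qInt (m + 1))⁻¹ * AWord (List.replicate k 1) m) := by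
  rw [z_one_pow, List.replicate_succ]
  induction w using induction_word with
  | hword u =>
    rw [circledast, bilinExt_word]
    cases u with
    | nil => simp [A_word, AWord, A_zero]
    | cons j u =>
      induction n with
      | zero => simp [A_z_mul_zero]
      | succ n ih =>
        rw [Finset.sum_range_succ, ← ih]
        simp only [A_z_mul_succ, A_starPlus, A_word, AWord_cons_succ]
        obtain ⟨j', hj⟩ := exists_coe_eq_add_one j
        rw [PNat.add_coe, hj, PNat.one_coe, Nat.add_sub_cancel, Nat.add_sub_cancel]
        ring
  | hadd x y hx hy =>
    rw [map_add, LinearMap.add_apply, A_add, hx, hy, ← Finset.sum_add_distrib]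
    refine Finset.sum_congr rfl fun m _ => ?_
    simp only [A_add]; ring
  | hsmul c x hx =>
    rw [map_smul, LinearMap.smul_apply, A_smul, hx, Finset.mul_sum]
    refine Finset.sum_congr rfl fun m _ => ?_
    simp only [A_smul]; ring

/-! ## Non-strict sums -/

/-- The sum `S_u(n) = ∑_{n ≥ m₁ ≥ ⋯ ≥ m_r > 0} ∏ᵢ (q^{mᵢ} / [mᵢ])^{kᵢ}`. -/
def starWord : List ℕ+ → ℕ → R
  | [], _ => 1
  | k :: u, n => ∑ m ∈ Finset.range n,
      (q ^ (m + 1) * (qInt (m + 1))⁻¹) ^ (k : ℕ) * starWord u (m + 1)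

theorem starWord_cons_zero (k : ℕ+) (u : List ℕ+) : starWord (k :: u) 0 = 0 := by
  simp [starWord]

theorem starWord_cons_succ (k : ℕ+) (u : List ℕ+) (n : ℕ) :
    starWord (k :: u) (n + 1) = starWord (k :: u) n +
      (q ^ (n + 1) * (qInt (n + 1))⁻¹) ^ (k : ℕ) * starWord u (n + 1) := by
  simp only [starWord, Finset.sum_range_succ]

/-- The semilinear extension of `u ↦ S_u(n)`. -/
def star (w : H1) (n : ℕ) : R := wordSum (fun u => starWord u n) w

theorem star_word (u : List ℕ+) (n : ℕ) : star (word u) n = starWord u n := wordSum_word _ _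

theorem star_add (w w' : H1) (n : ℕ) : star (w + w') n = star w n + star w' n :=
  wordSum_add _ _ _

theorem star_smul (c : Coeff) (w : H1) (n : ℕ) : star (c • w) n = coeffHom c * star w n :=
  wordSum_smul _ _ _

theorem star_neg (w : H1) (n : ℕ) : star (-w) n = -star w n := wordSum_neg _ _

theorem star_z_mul_zero (k : ℕ+) (w : H1) : star (z k * w) 0 = 0 := by
  induction w using induction_word with
  | hword u => rw [← word_cons, star_word, starWord_cons_zero]
  | hadd x y hx hy => rw [mul_add, star_add, hx, hy, add_zero]
  | hsmul c x hx => rw [mul_smul_comm, star_smul, hx, mul_zero]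

theorem star_z_mul_succ (k : ℕ+) (w : H1) (n : ℕ) :
    star (z k * w) (n + 1) = star (z k * w) n +
      (q ^ (n + 1) * (qInt (n + 1))⁻¹) ^ (k : ℕ) * star w (n + 1) := by
  induction w using induction_word with
  | hword u => rw [← word_cons, star_word, star_word, star_word, starWord_cons_succ]
  | hadd x y hx hy => simp only [mul_add, star_add, hx, hy]; ring
  | hsmul c x hx => simp only [mul_smul_comm, star_smul, hx]; ring

/-- The product `*̄` is the product of the non-strict sums. -/
theorem star_quasiShuffle (u v : List ℕ+) (n : ℕ) :
    star (quasiShuffle (fun i j => -z (i + j)) u v) n = starWord u n * starWord v n := by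
  set c : ℕ+ → ℕ+ → H1 := fun i j => -z (i + j) with hc
  induction u, v using quasiShuffle.induct generalizing n with
  | case1 v => rw [quasiShuffle, star_word, starWord, one_mul]
  | case2 i u => rw [quasiShuffle, star_word, starWord, mul_one]
  | case3 i u j v ih1 ih2 ih3 =>
    rw [quasiShuffle]
    induction n with
    | zero =>
      simp only [hc, neg_z_mul, star_add, star_neg, star_z_mul_zero]
      simp [starWord]
    | succ n ih =>
      simp only [hc, neg_z_mul, star_add, star_neg] at ih ⊢
      rw [← hc] at ih ⊢
      simp only [star_z_mul_succ, ih1, ih2, ih3, starWord_cons_succ] at ih ⊢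
      rw [PNat.add_coe, pow_add]
      -- In non-strict sums both leading terms include the diagonal, so it is counted twice and
      -- `-z_{i+j}` removes one copy.
      linear_combination ih

theorem star_starBar (w w' : H1) (n : ℕ) : star (starBar w w') n = star w n * star w' n := by
  induction w using induction_word with
  | hword u =>
    induction w' using induction_word with
    | hword v => rw [starBar, bilinExt_word, star_quasiShuffle, star_word, star_word]
    | hadd x y hx hy => rw [map_add, star_add, hx, hy, star_add, mul_add]
    | hsmul c x hx => rw [map_smul, star_smul, hx, star_smul, mul_left_comm]
  | hadd x y hx hy => rw [map_add, LinearMap.add_apply, star_add, hx, hy, star_add, add_mul]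
  | hsmul c x hx => rw [map_smul, LinearMap.smul_apply, star_smul, hx, star_smul, mul_assoc]

/-! ## The map `φ` on words -/

theorem weight_cons (i : ℕ+) (u : List ℕ+) : weight (i :: u) = i + weight u := by
  simp [weight]

theorem partialSums_singleton (i : ℕ+) : partialSums [i] = ∅ := by
  simp [partialSums]

theorem mem_partialSums_cons_cons (i k : ℕ+) (v : List ℕ+) (p : ℕ) :
    p ∈ partialSums (i :: k :: v) ↔ p = i ∨ ∃ p' ∈ partialSums (k :: v), p = i + p' := by
  simp only [partialSums, Finset.mem_image, Finset.mem_Ico]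
  constructor
  · rintro ⟨j, ⟨hj, hj'⟩, rfl⟩
    obtain ⟨j, rfl⟩ := Nat.exists_eq_add_of_le' hj
    rw [List.take_succ_cons, weight_cons]
    rcases Nat.eq_zero_or_pos j with rfl | hpos
    · left; simp [weight]
    · exact Or.inr ⟨_, ⟨j, ⟨hpos, by simpa using hj'⟩, rfl⟩, rfl⟩
  · rintro (rfl | ⟨_, ⟨j, ⟨hj, hj'⟩, rfl⟩, rfl⟩)
    · exact ⟨1, by simp, by simp [weight]⟩
    · exact ⟨j + 1, ⟨by omega, by simpa using hj'⟩, by rw [List.take_succ_cons, weight_cons]⟩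

theorem succ_mem_partialSums_one_cons (k : ℕ+) (v : List ℕ+) {p : ℕ} (hp : 1 ≤ p) :
    1 + p ∈ partialSums (1 :: k :: v) ↔ p ∈ partialSums (k :: v) := by
  rw [mem_partialSums_cons_cons]
  constructor
  · rintro (h | ⟨p', hp', h⟩)
    · simp at h; omega
    · simp at h; exact h ▸ hp'
  · exact fun h => Or.inr ⟨p, h, by simp⟩

theorem succ_mem_partialSums_succ_cons (k : ℕ+) (v : List ℕ+) (p : ℕ) :
    1 + p ∈ partialSums ((k + 1) :: v) ↔ p ∈ partialSums (k :: v) := by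
  cases v with
  | nil => simp [partialSums_singleton]
  | cons j v =>
    simp only [mem_partialSums_cons_cons, PNat.add_coe, PNat.one_coe]
    refine or_congr (by omega) (exists_congr fun p' => and_congr_right fun _ => by omega)

theorem one_notMem_partialSums_succ_cons (k : ℕ+) (v : List ℕ+) :
    1 ∉ partialSums ((k + 1) :: v) := by
  have hk := k.pos
  cases v with
  | nil => simp [partialSums_singleton]
  | cons j v =>
    rw [mem_partialSums_cons_cons, PNat.add_coe, PNat.one_coe]
    rintro (h | ⟨p', -, h⟩) <;> omega

theorem range'_two (n : ℕ) : List.range' 2 n = (List.range' 1 n).map (1 + ·) := by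
  rw [List.map_add_range']

theorem complementSums_one_cons (k : ℕ+) (v : List ℕ+) :
    complementSums (1 :: k :: v) = (complementSums (k :: v)).map (1 + ·) := by
  have h1 : 1 ∈ partialSums (1 :: k :: v) := by simp [mem_partialSums_cons_cons]
  rw [complementSums, weight_cons, PNat.one_coe, add_comm, List.range'_succ,
    List.filter_cons_of_neg (by simpa using h1), range'_two, List.filter_map, complementSums]
  congr 1
  refine List.filter_congr fun p hp => ?_
  have hp' : 1 ≤ p := (List.mem_range'_1.1 hp).1
  simp only [Function.comp, succ_mem_partialSums_one_cons k v hp']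

theorem complementSums_succ_cons (k : ℕ+) (v : List ℕ+) :
    complementSums ((k + 1) :: v) = 1 :: (complementSums (k :: v)).map (1 + ·) := by
  have hw : weight ((k + 1) :: v) = weight (k :: v) + 1 := by
    simp only [weight_cons, PNat.add_coe, PNat.one_coe]; omega
  rw [complementSums, hw, List.range'_succ,
    List.filter_cons_of_pos (by simpa using one_notMem_partialSums_succ_cons k v), range'_two,
    List.filter_map, complementSums]
  congr 2
  refine List.filter_congr fun p _ => ?_
  simp only [Function.comp, succ_mem_partialSums_succ_cons]

theorem differences_map_succ (a : ℕ) (l : List ℕ) :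
    differences (1 + a) (l.map (1 + ·)) = differences a l := by
  induction l generalizing a with
  | nil => rfl
  | cons p l ih => rw [List.map_cons, differences, differences, ih, Nat.add_sub_add_left]

theorem phiWord_singleton_one : phiWord [1] = [1] := by
  rw [phiWord, complementSums, partialSums_singleton, weight_cons]
  simp [weight, differences]
  rfl

/-- Raising the first letter shifts all partial sums by one and leaves `1` outside them, so the
complement is shifted and gains the new least element `1`. -/
theorem phiWord_succ_cons (k : ℕ+) (v : List ℕ+) :
    phiWord ((k + 1) :: v) = 1 :: phiWord (k :: v) := by
  rw [phiWord, complementSums_succ_cons, differences]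
  congr 1
  exact differences_map_succ 0 _

theorem complementSums_cons_ne_nil (k : ℕ+) (v : List ℕ+) : complementSums (k :: v) ≠ [] := by
  induction k using PNat.recOn with
  | succ k _ => rw [complementSums_succ_cons]; exact List.cons_ne_nil _ _
  | one =>
    induction v with
    | nil => simp [complementSums, partialSums_singleton, weight]
    | cons j v ih =>
      rw [complementSums_one_cons, Ne, List.map_eq_nil_iff]
      induction j using PNat.recOn with
      | succ k _ => rw [complementSums_succ_cons]; exact List.cons_ne_nil _ _
      | one => exact ih

/-- Prefixing `z₁` makes `1` a partial sum, so the complement is merely shifted and only its first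
difference grows. -/
theorem exists_phiWord_one_cons (k : ℕ+) (v : List ℕ+) :
    ∃ j w, phiWord (k :: v) = j :: w ∧ phiWord (1 :: k :: v) = (j + 1) :: w := by
  obtain ⟨p, l, hpl⟩ := List.exists_cons_of_ne_nil (complementSums_cons_ne_nil k v)
  have hp : 1 ≤ p := by
    have : p ∈ complementSums (k :: v) := by rw [hpl]; exact List.mem_cons_self
    exact (List.mem_range'_1.1 (List.mem_filter.1 this).1).1
  refine ⟨p.toPNat', differences p l, ?_, ?_⟩
  · rw [phiWord, hpl, differences, Nat.sub_zero]
  · rw [phiWord, complementSums_one_cons, hpl, List.map_cons, differences, differences_map_succ]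
    congr 1
    apply PNat.coe_injective
    simp only [PNat.add_coe, PNat.one_coe, Nat.toPNat'_coe]
    -- `toPNat'` sends `0` to the default `1`, which would spoil the increment; `1 ≤ p` excludes
    -- this.
    rw [if_pos (by omega), if_pos (by omega)]; omega

/-! ## The map `d` and the strict sums -/

theorem A_dWord_cons_zero (i : ℕ+) (v : List ℕ+) : A (dWord (i :: v)) 0 = 0 := by
  rw [dWord, A_add, A_z_mul_zero, A_circ_zero, add_zero]

/-- The map `d` allows equality between consecutive indices, at the cost of a factor `q^m`, since
merging two letters loses one of the two shifts in the `q`-exponent. -/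
theorem A_dWord_cons_succ_sub (i : ℕ+) (v : List ℕ+) (n : ℕ) :
    A (dWord (i :: v)) (n + 1) - A (dWord (i :: v)) n =
      q ^ (((i : ℕ) - 1) * (n + 1)) * (qInt (n + 1))⁻¹ ^ (i : ℕ) *
        (A (dWord v) n + q ^ (n + 1) * (A (dWord v) (n + 1) - A (dWord v) n)) := by
  rw [dWord, A_add, A_add, A_z_mul_succ, A_circ_succ]
  obtain ⟨i', hi⟩ := exists_coe_eq_add_one i
  rw [hi, Nat.add_sub_cancel]
  ring

theorem A_dWord_one_cons_succ_sub (v : List ℕ+) (n : ℕ) :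
    A (dWord (1 :: v)) (n + 1) - A (dWord (1 :: v)) n =
      (qInt (n + 1))⁻¹ *
        (A (dWord v) n + q ^ (n + 1) * (A (dWord v) (n + 1) - A (dWord v) n)) := by
  rw [A_dWord_cons_succ_sub]; simp

theorem A_dWord_succ_cons_succ_sub (i : ℕ+) (v : List ℕ+) (n : ℕ) :
    A (dWord ((i + 1) :: v)) (n + 1) - A (dWord ((i + 1) :: v)) n =
      q ^ (n + 1) * (qInt (n + 1))⁻¹ *
        (A (dWord (i :: v)) (n + 1) - A (dWord (i :: v)) n) := by
  rw [A_dWord_cons_succ_sub, A_dWord_cons_succ_sub]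
  obtain ⟨i', hi⟩ := exists_coe_eq_add_one i
  rw [PNat.add_coe, PNat.one_coe, hi, Nat.add_sub_cancel, Nat.add_sub_cancel]
  ring

/-! ## q-Newton polynomials -/

/-- The polynomial `∏_{0 ≤ j < m} (T + [j]) / [j + 1]`. -/
def newton : ℕ → Polynomial R
  | 0 => 1
  | m + 1 => newton m * (Polynomial.X + Polynomial.C (qInt m)) * Polynomial.C (qInt (m + 1))⁻¹

theorem newton_coeff_zero (m : ℕ) : (newton (m + 1)).coeff 0 = 0 := by
  induction m with
  | zero => simp [newton, qInt_zero]
  | succ m ih =>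
    rw [newton, Polynomial.coeff_mul_C, mul_add, Polynomial.coeff_add, Polynomial.coeff_mul_C, ih]
    simp

/-- As `[0] = 0`, the polynomial is `(T / [m+1]) ∏_{1 ≤ j ≤ m} (1 + T / [j])`, whose coefficients
are elementary symmetric functions of the `1 / [j]`. -/
theorem newton_coeff_succ (m k : ℕ) :
    (newton (m + 1)).coeff (k + 1) = (qInt (m + 1))⁻¹ * AWord (List.replicate k 1) m := by
  induction m generalizing k with
  | zero =>
    cases k with
    | zero => simp [newton, qInt_zero, AWord]
    | succ k => simp [newton, qInt_zero, AWord, List.replicate_succ]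
  | succ m ih =>
    rw [newton, Polynomial.coeff_mul_C, mul_add, Polynomial.coeff_add, Polynomial.coeff_mul_C, ih,
      Polynomial.coeff_mul_X]
    cases k with
    | zero =>
      rw [newton_coeff_zero]
      simp only [List.replicate_zero, AWord]
      linear_combination (qInt (m + 1 + 1))⁻¹ * qInt_mul_inv (Nat.le_add_left 1 m)
    | succ k =>
      rw [ih, List.replicate_succ, AWord_cons_succ]
      simp only [PNat.one_coe, Nat.sub_self, zero_mul, pow_zero, pow_one, one_mul]
      linear_combination (qInt (m + 1 + 1))⁻¹ * AWord (1 :: List.replicate k 1) m *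
        qInt_mul_inv (Nat.le_add_left 1 m)

theorem natDegree_newton_le (m : ℕ) : (newton m).natDegree ≤ m := by
  induction m with
  | zero => simp [newton]
  | succ m ih =>
    rw [newton]
    refine (Polynomial.natDegree_mul_C_le _ _).trans (Polynomial.natDegree_mul_le.trans ?_)
    rw [Polynomial.natDegree_X_add_C]
    omega

/-- The value of the `m`-th q-Newton polynomial at `-[n]`. -/
def newtonEval (m n : ℕ) : R := (newton m).eval (-qInt n)

theorem newtonEval_zero (n : ℕ) : newtonEval 0 n = 1 := by simp [newtonEval, newton]

theorem newtonEval_succ (m n : ℕ) :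
    newtonEval (m + 1) n = newtonEval m n * (qInt m - qInt n) * (qInt (m + 1))⁻¹ := by
  simp only [newtonEval, newton, Polynomial.eval_mul, Polynomial.eval_add, Polynomial.eval_X,
    Polynomial.eval_C]
  ring

theorem newtonEval_eq_zero {m n : ℕ} (h : n < m) : newtonEval m n = 0 := by
  induction m, h using Nat.le_induction with
  | base => rw [newtonEval_succ, sub_self, mul_zero, zero_mul]
  | succ m _ ih => rw [newtonEval_succ, ih, zero_mul, zero_mul]

/-- Comes from `[j+1] - [n+1] = q ([j] - [n])`, which shifts the factors of the product. -/
theorem q_pow_mul_newtonEval (m n : ℕ) :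
    q ^ m * qInt (n + 1) * newtonEval m n =
      (qInt (n + 1) - qInt m) * newtonEval m (n + 1) := by
  induction m with
  | zero => simp [newtonEval_zero, qInt_zero]
  | succ m ih =>
    rw [newtonEval_succ, newtonEval_succ]
    have h1 := qInt_succ m
    have h2 := qInt_succ n
    linear_combination q * (qInt m - qInt n) * (qInt (m + 1))⁻¹ * ih +
      (qInt (n + 1) - qInt m) * newtonEval m (n + 1) * (qInt (m + 1))⁻¹ * (h2 - h1)

/-- This is the q-Pascal rule: the values are `(-1)^m q^{m(m-1)/2}` times q-binomial coefficients.
-/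
theorem newtonEval_succ_succ (m n : ℕ) :
    newtonEval (m + 1) (n + 1) = q ^ (m + 1) * newtonEval (m + 1) n - q ^ m * newtonEval m n := by
  rw [newtonEval_succ m n, newtonEval_succ m (n + 1)]
  have h1 := qInt_succ m
  have h2 := qInt_succ n
  linear_combination (qInt (m + 1))⁻¹ * q_pow_mul_newtonEval m n + q ^ m * newtonEval m n *
    ((qInt (m + 1))⁻¹ * (h1 - h2) - qInt_mul_inv (Nat.le_add_left 1 m))

/-- The kernel converts the factor `q^m / [m]` followed by a difference in `n` into the factor `q^n
/ [n]`. This symmetry underlies both difference equations for Newton sums. -/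
theorem newtonEval_sub (m n : ℕ) :
    (qInt (m + 1))⁻¹ * (q ^ (m + 1) * (newtonEval (m + 1) (n + 1) - newtonEval (m + 1) n)) =
      q ^ (n + 1) * (qInt (n + 1))⁻¹ * newtonEval (m + 1) (n + 1) := by
  have h1 := qInt_mul_inv (Nat.le_add_left 1 m)
  have h2 := qInt_mul_inv (Nat.le_add_left 1 n)
  have h3 := one_sub_q_mul_qInt (m + 1)
  have h4 := one_sub_q_mul_qInt (n + 1)
  have h5 := q_pow_mul_newtonEval (m + 1) n
  generalize newtonEval (m + 1) (n + 1) = c at *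
  generalize newtonEval (m + 1) n = c' at *
  generalize (qInt (m + 1))⁻¹ = x at *
  generalize (qInt (n + 1))⁻¹ = y at *
  linear_combination -x * y * h5 + x * q ^ (m + 1) * c' * h2 - x * c * h2 + y * c * h1 +
    x * c * h3 - (1 - q) * c * h1 - y * c * h4 + (1 - q) * c * h2

/-! ## q-Newton series -/

/-- The Newton sum `∑_{1 ≤ m ≤ l} (a(m) - a(m-1)) q^m ∏_{0 ≤ j < m} ([j] - [n]) / [j + 1]`. -/
def newtonSum (a : ℕ → R) (l n : ℕ) : R :=
  ∑ m ∈ Finset.range l, (a (m + 1) - a m) * (q ^ (m + 1) * newtonEval (m + 1) n)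

theorem newtonSum_zero (a : ℕ → R) (l : ℕ) : newtonSum a l 0 = 0 :=
  Finset.sum_eq_zero fun m _ => by
    rw [newtonEval_eq_zero (Nat.succ_pos m), mul_zero, mul_zero]

theorem newtonSum_succ_sub_of_mul {a b : ℕ → R}
    (h : ∀ m, b (m + 1) - b m = q ^ (m + 1) * (qInt (m + 1))⁻¹ * (a (m + 1) - a m)) (l n : ℕ) :
    newtonSum b l (n + 1) - newtonSum b l n =
      q ^ (n + 1) * (qInt (n + 1))⁻¹ * newtonSum a l (n + 1) := by
  rw [newtonSum, newtonSum, newtonSum, ← Finset.sum_sub_distrib, Finset.mul_sum]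
  refine Finset.sum_congr rfl fun m _ => ?_
  rw [h]
  linear_combination (a (m + 1) - a m) * q ^ (m + 1) * newtonEval_sub m n

/-- Summation by parts: `newtonEval_sub` extracts `q^{n+1} / [n+1]`, and the q-Pascal rule turns the
rest into a telescoping sum. Its upper boundary term vanishes because `n < l`, leaving `-a(0)`. -/
theorem newtonSum_succ_sub_of_sum {a b : ℕ → R}
    (h : ∀ m, b (m + 1) - b m =
      (qInt (m + 1))⁻¹ * (a m + q ^ (m + 1) * (a (m + 1) - a m))) {l n : ℕ} (hn : n < l) :
    newtonSum b l (n + 1) - newtonSum b l n =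
      q ^ (n + 1) * (qInt (n + 1))⁻¹ * (newtonSum a l (n + 1) - newtonSum a l n - a 0) := by
  have htel : ∑ m ∈ Finset.range l, (a (m + 1) * (q ^ (m + 1) * newtonEval (m + 1) n) -
      a m * (q ^ m * newtonEval m n)) = -a 0 := by
    rw [Finset.sum_range_sub fun m => a m * (q ^ m * newtonEval m n), newtonEval_eq_zero hn,
      newtonEval_zero]
    ring
  rw [sub_eq_add_neg _ (a 0), ← htel, newtonSum, newtonSum, newtonSum, newtonSum,
    ← Finset.sum_sub_distrib, ← Finset.sum_sub_distrib, ← Finset.sum_add_distrib, Finset.mul_sum]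
  refine Finset.sum_congr rfl fun m _ => ?_
  rw [h]
  linear_combination (a m + q ^ (m + 1) * (a (m + 1) - a m)) * newtonEval_sub m n +
    q ^ (n + 1) * (qInt (n + 1))⁻¹ * a m * newtonEval_succ_succ m n

/-- Raising the first letter multiplies the increment of the non-strict sum by `q^n / [n]`, matching
a prefixed `z₁` on the dual side. The boundary value `a(0)` vanishes because the dual word is
non-empty. -/
theorem newtonSum_dWord_phiWord_succ_cons {k : ℕ+} {v : List ℕ+} {l : ℕ}
    (ih : ∀ n ≤ l, newtonSum (A (dWord (phiWord (k :: v)))) l n = -starWord (k :: v) n)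
    {n : ℕ} (hn : n ≤ l) :
    newtonSum (A (dWord (phiWord ((k + 1) :: v)))) l n = -starWord ((k + 1) :: v) n := by
  obtain ⟨j, w, hjw, -⟩ := exists_phiWord_one_cons k v
  rw [phiWord_succ_cons]
  induction n with
  | zero => rw [newtonSum_zero, starWord_cons_zero, neg_zero]
  | succ n ihn =>
    have h := newtonSum_succ_sub_of_sum (A_dWord_one_cons_succ_sub (phiWord (k :: v))) hn
    rw [ih _ hn, ih n (by omega), ihn (by omega), hjw, A_dWord_cons_zero, ← hjw,
      starWord_cons_succ] at h
    rw [starWord_cons_succ, PNat.add_coe, PNat.one_coe]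
    linear_combination h

/-- Prefixing `z₁` sums the previous non-strict sum against `q^n / [n]`, matching a raised first
letter on the dual side. -/
theorem newtonSum_dWord_phiWord_one_cons {k : ℕ+} {v : List ℕ+} {l : ℕ}
    (ih : ∀ n ≤ l, newtonSum (A (dWord (phiWord (k :: v)))) l n = -starWord (k :: v) n)
    {n : ℕ} (hn : n ≤ l) :
    newtonSum (A (dWord (phiWord (1 :: k :: v)))) l n = -starWord (1 :: k :: v) n := by
  obtain ⟨j, w, hjw, hjw'⟩ := exists_phiWord_one_cons k v
  rw [hjw']
  induction n with
  | zero => rw [newtonSum_zero, starWord_cons_zero, neg_zero]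
  | succ n ihn =>
    have h := newtonSum_succ_sub_of_mul (A_dWord_succ_cons_succ_sub j w) l n
    rw [← hjw, ih _ hn, ihn (by omega)] at h
    rw [starWord_cons_succ, PNat.one_coe]
    linear_combination h

theorem newtonSum_dWord_phiWord_singleton_one {l n : ℕ} (hn : n ≤ l) :
    newtonSum (A (dWord (phiWord [1]))) l n = -starWord [1] n := by
  rw [phiWord_singleton_one]
  induction n with
  | zero => rw [newtonSum_zero, starWord_cons_zero, neg_zero]
  | succ n ih =>
    have h := newtonSum_succ_sub_of_sum (A_dWord_one_cons_succ_sub []) hn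
    have h1 : ∀ n, newtonSum (A (dWord [])) l n = 0 := fun n =>
      Finset.sum_eq_zero fun m _ => by rw [dWord, A_one, A_one, sub_self, zero_mul]
    -- For the empty word both Newton sums vanish, but `a(0) = 1` supplies the summand `-q^{n+1} /
    -- [n+1]`.
    rw [h1, h1, dWord, A_one] at h
    rw [starWord_cons_succ, starWord, PNat.one_coe]
    linear_combination h + ih (by omega)

/-- The q-Newton series attached to `d(φ(u))` interpolates the non-strict sums of `u`. -/
theorem newtonSum_dWord_phiWord (k : ℕ+) (v : List ℕ+) {l n : ℕ} (hn : n ≤ l) :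
    newtonSum (A (dWord (phiWord (k :: v)))) l n = -starWord (k :: v) n := by
  induction v generalizing k n with
  | nil =>
    induction k using PNat.recOn generalizing n with
    | one => exact newtonSum_dWord_phiWord_singleton_one hn
    | succ k ih => exact newtonSum_dWord_phiWord_succ_cons (fun _ h => ih h) hn
  | cons j v ihv =>
    induction k using PNat.recOn generalizing n with
    | one => exact newtonSum_dWord_phiWord_one_cons (fun _ h => ihv j h) hn
    | succ k ih => exact newtonSum_dWord_phiWord_succ_cons (fun _ h => ih h) hn

/-! ## The relation -/

theorem d_phi_word (u : List ℕ+) : d (phi (word u)) = dWord (phiWord u) := by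
  rw [phi, linExt_word, d, linExt_word]

theorem newtonSum_d_phi {w : H1} (hw : w ∈ H1pos) {l n : ℕ} (hn : n ≤ l) :
    newtonSum (A (d (phi w))) l n = -star w n := by
  induction hw using Submodule.span_induction with
  | mem x hx =>
    obtain ⟨u, hu, rfl⟩ := hx
    obtain ⟨k, v, rfl⟩ := List.exists_cons_of_ne_nil hu
    rw [d_phi_word, star_word, newtonSum_dWord_phiWord k v hn]
  | zero => simp [newtonSum, A_zero, star, wordSum]
  | add x y _ _ hx hy =>
    rw [star_add, neg_add, ← hx, ← hy, newtonSum, newtonSum, newtonSum, ← Finset.sum_add_distrib]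
    refine Finset.sum_congr rfl fun m _ => ?_
    simp only [map_add, A_add]; ring
  | smul c x _ hx =>
    rw [star_smul, ← mul_neg, ← hx, newtonSum, newtonSum, Finset.mul_sum]
    refine Finset.sum_congr rfl fun m _ => ?_
    simp only [map_smul, A_smul]; ring

theorem z_mul_mem_H1pos (i : ℕ+) (w : H1) : z i * w ∈ H1pos := by
  induction w using induction_word with
  | hword u =>
    rw [← word_cons]
    exact Submodule.subset_span ⟨_, List.cons_ne_nil _ _, rfl⟩
  | hadd x y hx hy => rw [mul_add]; exact add_mem hx hy
  | hsmul c x hx => rw [mul_smul_comm]; exact Submodule.smul_mem _ _ hx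

/-- Needed because interpolation fails at the empty word: its Newton sum is `0`, while `-S_1(n) =
-1`. -/
theorem starBar_mem_H1pos {w w' : H1} (hw : w ∈ H1pos) (hw' : w' ∈ H1pos) :
    starBar w w' ∈ H1pos := by
  induction hw using Submodule.span_induction with
  | mem x hx =>
    obtain ⟨u, hu, rfl⟩ := hx
    induction hw' using Submodule.span_induction with
    | mem y hy =>
      obtain ⟨v, hv, rfl⟩ := hy
      obtain ⟨i, u, rfl⟩ := List.exists_cons_of_ne_nil hu
      obtain ⟨j, v, rfl⟩ := List.exists_cons_of_ne_nil hv
      rw [starBar, bilinExt_word, quasiShuffle, neg_z_mul]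
      exact add_mem (add_mem (z_mul_mem_H1pos _ _) (z_mul_mem_H1pos _ _))
        (neg_mem (z_mul_mem_H1pos _ _))
    | zero => rw [map_zero]; exact zero_mem _
    | add x y _ _ hx hy => rw [map_add]; exact add_mem hx hy
    | smul c x _ hx => rw [map_smul]; exact Submodule.smul_mem _ _ hx
  | zero => rw [map_zero]; exact zero_mem _
  | add x y _ _ hx hy => rw [map_add]; exact add_mem hx hy
  | smul c x _ hx => rw [map_smul]; exact Submodule.smul_mem _ _ hx

/-- The polynomial `∑_{1 ≤ m ≤ l} (a(m) - a(m-1)) q^m ∏_{0 ≤ j < m} (T + [j]) / [j + 1]`. -/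
def newtonPoly (a : ℕ → R) (l : ℕ) : Polynomial R :=
  ∑ m ∈ Finset.range l, Polynomial.C ((a (m + 1) - a m) * q ^ (m + 1)) * newton (m + 1)

theorem newtonPoly_coeff_zero (a : ℕ → R) (l : ℕ) : (newtonPoly a l).coeff 0 = 0 := by
  rw [newtonPoly, Polynomial.finsetSum_coeff]
  refine Finset.sum_eq_zero fun m _ => ?_
  rw [Polynomial.coeff_C_mul, newton_coeff_zero, mul_zero]

theorem newtonPoly_coeff (w : H1) (l : ℕ) {n : ℕ} (hn : 1 ≤ n) :
    (newtonPoly (A w) l).coeff n = A (circledast w (z 1 ^ n)) l := by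
  obtain ⟨n, rfl⟩ := Nat.exists_eq_add_of_le' hn
  rw [newtonPoly, Polynomial.finsetSum_coeff, A_circledast_z_one_pow]
  refine Finset.sum_congr rfl fun m _ => ?_
  rw [Polynomial.coeff_C_mul, newton_coeff_succ]
  ring

theorem newtonPoly_eval (a : ℕ → R) (l n : ℕ) :
    (newtonPoly a l).eval (-qInt n) = newtonSum a l n := by
  rw [newtonPoly, Polynomial.eval_finsetSum]
  refine Finset.sum_congr rfl fun m _ => ?_
  rw [Polynomial.eval_mul, Polynomial.eval_C, mul_assoc, newtonEval]

theorem natDegree_newtonPoly_le (a : ℕ → R) (l : ℕ) : (newtonPoly a l).natDegree ≤ l :=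
  Polynomial.natDegree_sum_le_of_forall_le _ _ fun _ hm =>
    (Polynomial.natDegree_C_mul_le _ _).trans
      ((natDegree_newton_le _).trans (Finset.mem_range.1 hm))

theorem C_q_pow_dvd_newtonPoly_sub (a : ℕ → R) (k j : ℕ) :
    Polynomial.C (q ^ (k + 1)) ∣ newtonPoly a (k + j) - newtonPoly a k := by
  rw [newtonPoly, newtonPoly, Finset.sum_range_add, add_sub_cancel_left]
  refine Finset.dvd_sum fun m _ => Dvd.dvd.mul_right (map_dvd _ (Dvd.dvd.mul_left ?_ _)) _
  exact pow_dvd_pow _ (by omega)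

/-- A polynomial that vanishes on `s` and is congruent modulo `a` to a polynomial of degree less
than `#s` is divisible by `a`. -/
theorem C_dvd_of_eval_eq_zero {S : Type*} [CommRing S] [IsDomain S] {s : Finset S}
    {f g : Polynomial S} {a : S} (hf : ∀ x ∈ s, f.eval x = 0) (hg : g.natDegree < s.card)
    (h : Polynomial.C a ∣ f - g) : Polynomial.C a ∣ f := by
  rcases eq_or_ne f 0 with rfl | hf0
  · exact dvd_zero _
  set e : Polynomial S := (s.val.map fun x => Polynomial.X - Polynomial.C x).prod with he
  have hmonic : e.Monic := Polynomial.monic_multisetProd_X_sub_C _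
  have hdeg : e.natDegree = s.card := Polynomial.natDegree_multiset_prod_X_sub_C_eq_card _
  have hef : e ∣ f := (Multiset.prod_X_sub_C_dvd_iff_le_roots hf0 _).2
    ((Multiset.le_iff_subset s.nodup).2 fun x hx =>
      (Polynomial.mem_roots hf0).2 (hf x hx))
  obtain ⟨r, hr⟩ := h
  have hmod := Polynomial.modByMonic_add_div r e
  -- Replacing `r` by its remainder changes `f` by a multiple of `e`, so the result is still
  -- divisible by `e` but has smaller degree. Monic division avoids counting roots modulo `a`, where
  -- distinct zeros may coincide.
  have hzero : g + Polynomial.C a * (r %ₘ e) = 0 := by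
    refine Polynomial.eq_zero_of_dvd_of_natDegree_lt (p := e) ?_ ?_
    · have : g + Polynomial.C a * (r %ₘ e) = f - e * (Polynomial.C a * (r /ₘ e)) := by
        linear_combination -hr + Polynomial.C a * hmod
      rw [this]
      exact dvd_sub hef (dvd_mul_right _ _)
    · refine (Polynomial.natDegree_add_le _ _).trans_lt (max_lt (hdeg ▸ hg) ?_)
      refine (Polynomial.natDegree_C_mul_le _ _).trans_lt
        (Polynomial.natDegree_modByMonic_lt _ hmonic fun h1 => ?_)
      rw [h1, Polynomial.natDegree_one] at hdeg
      omega
  exact ⟨e * (r /ₘ e), by linear_combination hr - Polynomial.C a * hmod + hzero⟩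

/-- Truncation at `2k` gives `2k + 1` exact zeros. The product could have degree `4k`, but modulo
`q^{k+1}` its factors may be cut at `k`, bringing the degree down to `2k`. -/
theorem C_q_pow_dvd_newtonPoly_add_mul {w₁ w₂ : H1} (hw₁ : w₁ ∈ H1pos) (hw₂ : w₂ ∈ H1pos)
    (k : ℕ) : Polynomial.C (q ^ (k + 1)) ∣
      newtonPoly (A (d (phi (starBar w₁ w₂)))) (k + k) +
        newtonPoly (A (d (phi w₁))) (k + k) * newtonPoly (A (d (phi w₂))) (k + k) := by
  refine C_dvd_of_eval_eq_zero
    (s := (Finset.range (k + k + 1)).map ⟨fun n => -qInt n, neg_injective.comp qInt_injective⟩)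
    (g := newtonPoly (A (d (phi (starBar w₁ w₂)))) (k + k) +
      newtonPoly (A (d (phi w₁))) k * newtonPoly (A (d (phi w₂))) k) ?_ ?_ ?_
  · intro x hx
    obtain ⟨n, hn, rfl⟩ := Finset.mem_map.1 hx
    have hn' : n ≤ k + k := Nat.lt_succ_iff.1 (Finset.mem_range.1 hn)
    rw [Function.Embedding.coeFn_mk, Polynomial.eval_add, Polynomial.eval_mul, newtonPoly_eval, newtonPoly_eval,
      newtonPoly_eval, newtonSum_d_phi (starBar_mem_H1pos hw₁ hw₂) hn', newtonSum_d_phi hw₁ hn',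
      newtonSum_d_phi hw₂ hn', star_starBar]
    ring
  · rw [Finset.card_map, Finset.card_range,
      Nat.lt_succ_iff]
    refine (Polynomial.natDegree_add_le _ _).trans (max_le (natDegree_newtonPoly_le _ _) ?_)
    exact Polynomial.natDegree_mul_le.trans
      (add_le_add (natDegree_newtonPoly_le _ _) (natDegree_newtonPoly_le _ _))
  · rw [add_sub_add_left_eq_sub]
    obtain ⟨x, hx⟩ := C_q_pow_dvd_newtonPoly_sub (A (d (phi w₁))) k k
    obtain ⟨y, hy⟩ := C_q_pow_dvd_newtonPoly_sub (A (d (phi w₂))) k k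
    exact ⟨x * newtonPoly (A (d (phi w₂))) (k + k) + newtonPoly (A (d (phi w₁))) k * y, by
      linear_combination newtonPoly (A (d (phi w₂))) (k + k) * hx +
        newtonPoly (A (d (phi w₁))) k * hy⟩

/-- The finite form of the relation, valid modulo `q^{k+1}`. -/
theorem q_pow_dvd_A_add_sum {w₁ w₂ : H1} (hw₁ : w₁ ∈ H1pos) (hw₂ : w₂ ∈ H1pos) {n : ℕ}
    (hn : 1 ≤ n) (k : ℕ) :
    q ^ (k + 1) ∣ A (circledast (d (phi (starBar w₁ w₂))) (z 1 ^ n)) (k + k) +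
      ∑ p ∈ (Finset.HasAntidiagonal.antidiagonal n).filter (fun p => 1 ≤ p.1 ∧ 1 ≤ p.2),
        A (circledast (d (phi w₁)) (z 1 ^ p.1)) (k + k) *
          A (circledast (d (phi w₂)) (z 1 ^ p.2)) (k + k) := by
  have h := (Polynomial.C_dvd_iff_dvd_coeff _ _).1
    (C_q_pow_dvd_newtonPoly_add_mul hw₁ hw₂ k) n
  rw [Polynomial.coeff_add, Polynomial.coeff_mul, newtonPoly_coeff _ _ hn,
    ← Finset.sum_filter_of_ne (p := fun p : ℕ × ℕ => 1 ≤ p.1 ∧ 1 ≤ p.2)] at h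
  · convert h using 2
    refine Finset.sum_congr rfl fun p hp => ?_
    obtain ⟨h1, h2⟩ := (Finset.mem_filter.1 hp).2
    rw [newtonPoly_coeff _ _ h1, newtonPoly_coeff _ _ h2]
  · intro p _ hp
    refine ⟨Nat.one_le_iff_ne_zero.2 fun h0 => hp ?_, Nat.one_le_iff_ne_zero.2 fun h0 => hp ?_⟩
    · rw [h0, newtonPoly_coeff_zero, zero_mul]
    · rw [h0, newtonPoly_coeff_zero, mul_zero]

/-! ### Passage to the q-adic limit -/

theorem eventually_q_pow_dvd_A_sub_zetaQ (w w' : H1) (k : ℕ) :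
    ∀ᶠ n in atTop, q ^ k ∣ A (circledast w w') n - zetaQ (circledast w w') :=
  tendsto_qAdic_iff.1 (tendsto_zetaQ (circledast_mem_H0 w w')) k

theorem eq_zero_of_forall_q_pow_dvd {x : R} (h : ∀ k, q ^ k ∣ x) : x = 0 := by
  ext m
  exact PowerSeries.X_pow_dvd_iff.1 (h (m + 1)) m (Nat.lt_succ_self m)

end

end QMZV

open QMZV
theorem mainTheorem1 (w₁ w₂ : H1) (hw₁ : w₁ ∈ H1pos) (hw₂ : w₂ ∈ H1pos) (n : ℕ) (hn : 1 ≤ n) :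
    zetaQ (circledast (d (phi (starBar w₁ w₂))) (z 1 ^ n)) +
      ∑ p ∈ (Finset.HasAntidiagonal.antidiagonal n).filter (fun p => 1 ≤ p.1 ∧ 1 ≤ p.2),
        zetaQ (circledast (d (phi w₁)) (z 1 ^ p.1)) *
          zetaQ (circledast (d (phi w₂)) (z 1 ^ p.2)) = 0 := by
  refine eq_zero_of_forall_q_pow_dvd fun k => ?_
  have h₁ := fun m => eventually_q_pow_dvd_A_sub_zetaQ (d (phi w₁)) (z 1 ^ m) k
  have h₂ := fun m => eventually_q_pow_dvd_A_sub_zetaQ (d (phi w₂)) (z 1 ^ m) k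
  have hs := (Filter.eventually_all_finset (Finset.HasAntidiagonal.antidiagonal n)).2
    fun p _ => (h₁ p.1).and (h₂ p.2)
  obtain ⟨N, hN⟩ := eventually_atTop.1
    ((eventually_q_pow_dvd_A_sub_zetaQ (d (phi (starBar w₁ w₂))) (z 1 ^ n) k).and hs)
  -- The finite relation needs an even truncation; half-length `N + k` exceeds the threshold `N`
  -- once doubled and gives precision at least `q^k`.
  obtain ⟨h0, hp⟩ := hN ((N + k) + (N + k)) (by omega)
  have h := (pow_dvd_pow q (show k ≤ N + k + 1 by omega)).trans (q_pow_dvd_A_add_sum hw₁ hw₂ hn (N + k))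
  refine (dvd_iff_dvd_of_dvd_sub ?_).1 h
  rw [add_sub_add_comm, ← Finset.sum_sub_distrib]
  refine dvd_add h0 (Finset.dvd_sum fun p hpn => ?_)
  obtain ⟨⟨x, hx⟩, ⟨y, hy⟩⟩ := hp p (Finset.mem_filter.1 hpn).1
  -- From `AB - ab = (A - a)B + a(B - b)`.
  exact ⟨x * A (circledast (d (phi w₂)) (z 1 ^ p.2)) (N + k + (N + k)) +
      zetaQ (circledast (d (phi w₁)) (z 1 ^ p.1)) * y, by
    linear_combination A (circledast (d (phi w₂)) (z 1 ^ p.2)) (N + k + (N + k)) * hx +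
      zetaQ (circledast (d (phi w₁)) (z 1 ^ p.1)) * hy⟩
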